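/- Let $n\ge 0$ and $r\ge 1$ be integers, and let $f,g:(\mathbb{R}^n,0)\to(\mathbb{R},0)$ be functions of class $C^{r+1}$ in a neighbourhood of $0$ (so $f(0)=g(0)=0$) with $\nabla f(0)=0$. Suppose that there exist a neighbourhood $U$ of $0\in\mathbb{R}^n$ and a constant $C>0$ such that $$|\partial^m(g-f)(x)|\le C\,|\nabla f(x)|^{\,r+2-|m|}\qquad\text{for all } x\in U$$ and for every multi-index $m\in\mathbb{N}_0^n$ with $|m|=m_1+\dots+m_n\le r$, where $\partial^m=\partial_1^{m_1}\cdots\partial_n^{m_n}$ and $|\nabla f(x)|$ is the Euclidean norm. Then $f$ and $g$ are $C^r$-right equivalent: there exists a $C^r$ diffeomorphism $\varphi$ from an open neighbourhood of $0$ in $\mathbb{R}^n$ onto an open neighbourhood of $0$ in $\mathbb{R}^n$ (so $\varphi^{-1}$ is also of class $C^r$), with $\varphi(0)=0$, such that $f=g\circ\varphi$ in a neighbourhood of $0$. -/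

import Mathlib

open Topology

/-- The partial derivative `∂u/∂xᵢ` of `u : ℝⁿ → ℝ`. -/
noncomputable def partialDeriv {n : ℕ} (i : Fin n) (u : EuclideanSpace ℝ (Fin n) → ℝ) :
    EuclideanSpace ℝ (Fin n) → ℝ :=
  fun x => lineDeriv ℝ u x (EuclideanSpace.single i 1)

/-- The partial derivative `∂ᵐu = ∂₁^{m₁} ⋯ ∂ₙ^{mₙ} u` for a multi-index `m`. -/
noncomputable def multiPartialDeriv {n : ℕ} (m : Fin n → ℕ)
    (u : EuclideanSpace ℝ (Fin n) → ℝ) : EuclideanSpace ℝ (Fin n) → ℝ :=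
  (List.finRange n).foldr (fun i v => (partialDeriv i)^[m i] v) u

/-- `f` and `g` are `C^r`-right equivalent at the origin: there is a `C^r` diffeomorphism `φ`
between open neighbourhoods of `0` in `ℝⁿ`, with `φ 0 = 0`, such that `f = g ∘ φ` near `0`. -/
def RightEquivalent {n : ℕ} (r : ℕ) (f g : EuclideanSpace ℝ (Fin n) → ℝ) : Prop :=
  ∃ φ : OpenPartialHomeomorph (EuclideanSpace ℝ (Fin n)) (EuclideanSpace ℝ (Fin n)),
    0 ∈ φ.source ∧ φ 0 = 0 ∧
    ContDiffOn ℝ r φ φ.source ∧ ContDiffOn ℝ r φ.symm φ.target ∧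
    ∀ᶠ x in 𝓝 0, f x = g (φ x)

/-! Put w = |∇f| and r = p + 1. Where w > 0, seek φ(x) = x + s(x)∇f(x) with a scalar s. Near 0 the
gradient of g stays close to ∇f(x) along the segment, so t ↦ g(x + t∇f(x)) - f(x) has slope at least
w²/2. Its value at t = 0 is O(w^(r+2)), hence it has a unique small root s(x) = O(w^r)
(`exists_root_of_le_deriv`), of class C^r by the implicit function theorem
(`contDiffAt_of_eventually_unique`).

The difficulty is the critical set w = 0. There the scale is w itself: each derivative costs one
power of w. Differentiating g(x + s∇f) = f and inducting on the order gives Dʲs = O(w^(r-j))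
(`WeightedBound.of_apply_add_smul_eq`), so v = s∇f satisfies Dʲv = O(w^(r+1-j)). For j ≤ r these are
all O(w), and w is Lipschitz, so v, which vanishes on the critical set, is C^r across it
(`WeightedBound.contDiffOn`). On the critical set the hypothesis gives g = f, so f = g ∘ (id + v)
holds there too. Finally Dv(0) = 0, and the inverse function theorem makes id + v a local C^r
diffeomorphism. -/

/-- `u` and its derivatives up to order `k` satisfy `‖Dʲu‖ ≤ C w ^ (a - j)` on `S`. -/
def WeightedBound {E : Type} [NormedAddCommGroup E] [NormedSpace ℝ E] (w : E → ℝ) (S : Set E) :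
    ℕ → ℤ → ∀ {V : Type} [NormedAddCommGroup V] [NormedSpace ℝ V], (E → V) → Prop
  | 0, a, _, _, _, u => ∃ C : ℝ, ∀ x ∈ S, ‖u x‖ ≤ C * w x ^ a
  | k + 1, a, _, _, _, u => (∃ C : ℝ, ∀ x ∈ S, ‖u x‖ ≤ C * w x ^ a) ∧
      (∀ x ∈ S, DifferentiableAt ℝ u x) ∧ WeightedBound w S k (a - 1) (fderiv ℝ u)

/-! ### Calculus of weighted bounds -/

namespace WeightedBound

variable {E : Type} [NormedAddCommGroup E] [NormedSpace ℝ E] {w : E → ℝ} {S : Set E}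
  {V : Type} [NormedAddCommGroup V] [NormedSpace ℝ V]

theorem bound {k : ℕ} {a : ℤ} {u : E → V} (h : WeightedBound w S k a u) :
    ∃ C : ℝ, ∀ x ∈ S, ‖u x‖ ≤ C * w x ^ a := by
  cases k with
  | zero => exact h
  | succ k => exact h.1

theorem bound_nonneg (hw : ∀ x ∈ S, 0 < w x) {k : ℕ} {a : ℤ} {u : E → V}
    (h : WeightedBound w S k a u) : ∃ C : ℝ, 0 ≤ C ∧ ∀ x ∈ S, ‖u x‖ ≤ C * w x ^ a := by
  obtain ⟨C, hC⟩ := h.bound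
  refine ⟨|C|, abs_nonneg C, fun x hx => (hC x hx).trans ?_⟩
  exact mul_le_mul_of_nonneg_right (le_abs_self C) (zpow_nonneg (hw x hx).le a)

theorem of_succ {k : ℕ} : ∀ {a : ℤ} {V : Type} [NormedAddCommGroup V] [NormedSpace ℝ V]
    {u : E → V}, WeightedBound w S (k + 1) a u → WeightedBound w S k a u := by
  induction k with
  | zero => intro a V _ _ u h; exact h.1
  | succ k ih => intro a V _ _ u h; exact ⟨h.1, h.2.1, ih h.2.2⟩

theorem of_le {k l : ℕ} (hkl : k ≤ l) {a : ℤ} {u : E → V} (h : WeightedBound w S l a u) :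
    WeightedBound w S k a u := by
  induction l, hkl using Nat.le_induction with
  | base => exact h
  | succ l _ ih => exact ih h.of_succ

theorem mono_set {T : Set E} (hTS : T ⊆ S) {k : ℕ} : ∀ {a : ℤ} {V : Type} [NormedAddCommGroup V]
    [NormedSpace ℝ V] {u : E → V}, WeightedBound w S k a u → WeightedBound w T k a u := by
  induction k with
  | zero =>
    rintro a V _ _ u ⟨C, hC⟩
    exact ⟨C, fun x hx => hC x (hTS hx)⟩
  | succ k ih =>
    rintro a V _ _ u ⟨⟨C, hC⟩, hd, h⟩
    exact ⟨⟨C, fun x hx => hC x (hTS hx)⟩, fun x hx => hd x (hTS hx), ih h⟩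

theorem mono_exp (hw : ∀ x ∈ S, 0 < w x) (hw1 : ∀ x ∈ S, w x ≤ 1) {k : ℕ} :
    ∀ {a b : ℤ} (_ : b ≤ a) {V : Type} [NormedAddCommGroup V] [NormedSpace ℝ V] {u : E → V},
      WeightedBound w S k a u → WeightedBound w S k b u := by
  have key : ∀ {a b : ℤ} (_ : b ≤ a) {V : Type} [NormedAddCommGroup V] [NormedSpace ℝ V]
      {u : E → V} {k : ℕ}, WeightedBound w S k a u →
      ∃ C : ℝ, ∀ x ∈ S, ‖u x‖ ≤ C * w x ^ b := by
    intro a b hab V _ _ u k h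
    obtain ⟨C, hC0, hC⟩ := h.bound_nonneg hw
    exact ⟨C, fun x hx => (hC x hx).trans <| mul_le_mul_of_nonneg_left
      (zpow_le_zpow_right_of_le_one₀ (hw x hx) (hw1 x hx) hab) hC0⟩
  induction k with
  | zero => intro a b hab V _ _ u h; exact key hab h
  | succ k ih =>
    intro a b hab V _ _ u h
    exact ⟨key hab h, h.2.1, ih (by omega) h.2.2⟩

theorem congr (hS : IsOpen S) {k : ℕ} : ∀ {a : ℤ} {V : Type} [NormedAddCommGroup V]
    [NormedSpace ℝ V] {u v : E → V}, WeightedBound w S k a u → (∀ x ∈ S, v x = u x) →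
      WeightedBound w S k a v := by
  induction k with
  | zero =>
    rintro a V _ _ u v ⟨C, hC⟩ huv
    exact ⟨C, fun x hx => by rw [huv x hx]; exact hC x hx⟩
  | succ k ih =>
    rintro a V _ _ u v ⟨⟨C, hC⟩, hd, h⟩ huv
    have he : ∀ x ∈ S, v =ᶠ[𝓝 x] u := fun x hx =>
      Filter.eventually_of_mem (hS.mem_nhds hx) huv
    refine ⟨⟨C, fun x hx => by rw [huv x hx]; exact hC x hx⟩,
      fun x hx => (hd x hx).congr_of_eventuallyEq (he x hx), ih h fun x hx => ?_⟩
    exact (he x hx).fderiv_eq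

theorem add (hS : IsOpen S) {k : ℕ} : ∀ {a : ℤ} {V : Type} [NormedAddCommGroup V]
    [NormedSpace ℝ V] {u v : E → V}, WeightedBound w S k a u → WeightedBound w S k a v →
      WeightedBound w S k a (fun x => u x + v x) := by
  have key : ∀ {a : ℤ} {V : Type} [NormedAddCommGroup V] [NormedSpace ℝ V] {u v : E → V} {k : ℕ},
      WeightedBound w S k a u → WeightedBound w S k a v →
      ∃ C : ℝ, ∀ x ∈ S, ‖u x + v x‖ ≤ C * w x ^ a := by
    intro a V _ _ u v k hu hv
    obtain ⟨C, hC⟩ := hu.bound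
    obtain ⟨D, hD⟩ := hv.bound
    refine ⟨C + D, fun x hx => (norm_add_le _ _).trans ?_⟩
    rw [add_mul]
    exact add_le_add (hC x hx) (hD x hx)
  induction k with
  | zero => intro a V _ _ u v hu hv; exact key hu hv
  | succ k ih =>
    intro a V _ _ u v hu hv
    refine ⟨key hu hv, fun x hx => (hu.2.1 x hx).add (hv.2.1 x hx),
      (ih hu.2.2 hv.2.2).congr hS fun x hx => ?_⟩
    exact fderiv_fun_add (hu.2.1 x hx) (hv.2.1 x hx)

theorem clm_apply (hS : IsOpen S) {k : ℕ} : ∀ {a : ℤ} {V W : Type}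
    [NormedAddCommGroup V] [NormedSpace ℝ V] [NormedAddCommGroup W] [NormedSpace ℝ W] {u : E → V}
    (L : V →L[ℝ] W), WeightedBound w S k a u → WeightedBound w S k a (fun x => L (u x)) := by
  have key : ∀ {a : ℤ} {V W : Type}
      [NormedAddCommGroup V] [NormedSpace ℝ V] [NormedAddCommGroup W] [NormedSpace ℝ W] {u : E → V}
      {k : ℕ} (L : V →L[ℝ] W), WeightedBound w S k a u →
      ∃ C : ℝ, ∀ x ∈ S, ‖L (u x)‖ ≤ C * w x ^ a := by
    intro a V W _ _ _ _ u k L hu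
    obtain ⟨C, hC⟩ := hu.bound
    refine ⟨‖L‖ * C, fun x hx => (L.le_opNorm _).trans ?_⟩
    rw [mul_assoc]
    exact mul_le_mul_of_nonneg_left (hC x hx) (norm_nonneg _)
  induction k with
  | zero => intro a V W _ _ _ _ u L hu; exact key L hu
  | succ k ih =>
    intro a V W _ _ _ _ u L hu
    refine ⟨key L hu, fun x hx => L.differentiableAt.comp x (hu.2.1 x hx),
      (ih (ContinuousLinearMap.compL ℝ E V W L) hu.2.2).congr hS fun x hx => ?_⟩
    exact (L.hasFDerivAt.comp x (hu.2.1 x hx).hasFDerivAt).fderiv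

theorem neg (hS : IsOpen S) {k : ℕ} {a : ℤ} {u : E → V}
    (hu : WeightedBound w S k a u) : WeightedBound w S k a (fun x => -u x) :=
  (hu.clm_apply hS (-ContinuousLinearMap.id ℝ V)).congr hS fun x _ => by simp

theorem sub (hS : IsOpen S) {k : ℕ} {a : ℤ} {u v : E → V}
    (hu : WeightedBound w S k a u) (hv : WeightedBound w S k a v) :
    WeightedBound w S k a (fun x => u x - v x) :=
  (hu.add hS (hv.neg hS)).congr hS fun _ _ => sub_eq_add_neg _ _

/-- Leibniz rule. Both terms of the derivative are again bilinear pairings, via `precompR` and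
`precompL`, so the induction closes only for arbitrary bilinear maps between arbitrary spaces. One
factor loses a power of w in each term. -/
theorem bilinear (hw : ∀ x ∈ S, 0 < w x) (hS : IsOpen S) {k : ℕ} : ∀ {a b : ℤ} {V W Y : Type}
    [NormedAddCommGroup V] [NormedSpace ℝ V] [NormedAddCommGroup W] [NormedSpace ℝ W]
    [NormedAddCommGroup Y] [NormedSpace ℝ Y] {u : E → V} {v : E → W} (B : V →L[ℝ] W →L[ℝ] Y),
    WeightedBound w S k a u → WeightedBound w S k b v →
      WeightedBound w S k (a + b) (fun x => B (u x) (v x)) := by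
  have key : ∀ {a b : ℤ} {V W Y : Type}
      [NormedAddCommGroup V] [NormedSpace ℝ V] [NormedAddCommGroup W] [NormedSpace ℝ W]
      [NormedAddCommGroup Y] [NormedSpace ℝ Y] {u : E → V} {v : E → W} {k : ℕ}
      (B : V →L[ℝ] W →L[ℝ] Y), WeightedBound w S k a u → WeightedBound w S k b v →
      ∃ C : ℝ, ∀ x ∈ S, ‖B (u x) (v x)‖ ≤ C * w x ^ (a + b) := by
    intro a b V W Y _ _ _ _ _ _ u v k B hu hv
    obtain ⟨C, hC0, hC⟩ := hu.bound_nonneg hw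
    obtain ⟨D, hD⟩ := hv.bound
    refine ⟨‖B‖ * C * D, fun x hx => (B.le_opNorm₂ _ _).trans ?_⟩
    have h1 : 0 ≤ ‖B‖ * (C * w x ^ a) :=
      mul_nonneg (norm_nonneg B) (mul_nonneg hC0 (zpow_nonneg (hw x hx).le _))
    calc ‖B‖ * ‖u x‖ * ‖v x‖ ≤ ‖B‖ * (C * w x ^ a) * (D * w x ^ b) :=
          mul_le_mul (mul_le_mul_of_nonneg_left (hC x hx) (norm_nonneg B)) (hD x hx)
            (norm_nonneg _) h1
      _ = ‖B‖ * C * D * w x ^ (a + b) := by rw [zpow_add₀ (hw x hx).ne']; ring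
  induction k with
  | zero => intro a b V W Y _ _ _ _ _ _ u v B hu hv; exact key B hu hv
  | succ k ih =>
    intro a b V W Y _ _ _ _ _ _ u v B hu hv
    have hd : ∀ x ∈ S, HasFDerivAt (fun x => B (u x) (v x))
        (B.precompR E (u x) (fderiv ℝ v x) + B.precompL E (fderiv ℝ u x) (v x)) x := fun x hx =>
      B.hasFDerivAt_of_bilinear (hu.2.1 x hx).hasFDerivAt (hv.2.1 x hx).hasFDerivAt
    refine ⟨key B hu hv, fun x hx => (hd x hx).differentiableAt, ?_⟩
    have h1 := ih (B.precompR E) hu.of_succ hv.2.2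
    have h2 := ih (B.precompL E) hu.2.2 hv.of_succ
    rw [show a + (b - 1) = a + b - 1 by ring] at h1
    rw [show a - 1 + b = a + b - 1 by ring] at h2
    exact (h1.add hS h2).congr hS fun x hx => (hd x hx).fderiv

theorem smul (hw : ∀ x ∈ S, 0 < w x) (hS : IsOpen S) {k : ℕ} {a b : ℤ} {u : E → ℝ} {v : E → V}
    (hu : WeightedBound w S k a u) (hv : WeightedBound w S k b v) :
    WeightedBound w S k (a + b) (fun x => u x • v x) :=
  bilinear hw hS (ContinuousLinearMap.lsmul ℝ ℝ) hu hv

/-- The derivative of 1/u is -u⁻² Du, of exponent -2a + (a - 1) = -a - 1, so the bound at order k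
feeds the one at order k + 1. -/
theorem inv (hw : ∀ x ∈ S, 0 < w x) (hS : IsOpen S) {a : ℤ} {u : E → ℝ} {c : ℝ} (hc : 0 < c)
    (hcu : ∀ x ∈ S, c * w x ^ a ≤ ‖u x‖) {k : ℕ} (hu : WeightedBound w S k a u) :
    WeightedBound w S k (-a) (fun x => (u x)⁻¹) := by
  have hne : ∀ x ∈ S, u x ≠ 0 := fun x hx =>
    norm_pos_iff.1 ((mul_pos hc (zpow_pos (hw x hx) a)).trans_le (hcu x hx))
  have key : ∃ C : ℝ, ∀ x ∈ S, ‖(u x)⁻¹‖ ≤ C * w x ^ (-a) := by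
    refine ⟨c⁻¹, fun x hx => ?_⟩
    rw [norm_inv, zpow_neg, ← mul_inv]
    exact inv_anti₀ (mul_pos hc (zpow_pos (hw x hx) a)) (hcu x hx)
  induction k with
  | zero => exact key
  | succ k ih =>
    have hd : ∀ x ∈ S, HasFDerivAt (fun x => (u x)⁻¹) (-(((u x)⁻¹ * (u x)⁻¹) • fderiv ℝ u x)) x := by
      intro x hx
      have := (hasDerivAt_inv (hne x hx)).comp_hasFDerivAt x (hu.2.1 x hx).hasFDerivAt
      rwa [neg_smul, sq, mul_inv] at this
    refine ⟨key, fun x hx => (hd x hx).differentiableAt, ?_⟩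
    have hi := ih hu.of_succ
    have h1 := ((hi.smul hw hS hi).smul hw hS hu.2.2).neg hS
    rw [show -a + -a + (a - 1) = -a - 1 by ring] at h1
    exact h1.congr hS fun x hx => (hd x hx).fderiv

/-- Since w is comparable at x and x + v(x), bounds of u transfer to the displaced point. Exponent 1
for v makes Dv bounded, so the chain rule costs no extra power. -/
theorem comp_id_add (hw : ∀ x ∈ S, 0 < w x) (hS : IsOpen S) {T : Set E}
    (hwT : ∀ x ∈ T, 0 < w x) {v : E → E} (hST : ∀ x ∈ S, x + v x ∈ T) {c d : ℝ} (hc : 0 < c)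
    (hcw : ∀ x ∈ S, c * w x ≤ w (x + v x)) (hwd : ∀ x ∈ S, w (x + v x) ≤ d * w x) {k : ℕ} :
    ∀ {a : ℤ} {V : Type} [NormedAddCommGroup V] [NormedSpace ℝ V] {u : E → V},
      WeightedBound w S k 1 v → WeightedBound w T k a u →
      WeightedBound w S k a (fun x => u (x + v x)) := by
  have key : ∀ {a : ℤ} {V : Type} [NormedAddCommGroup V] [NormedSpace ℝ V] {u : E → V} {k : ℕ},
      WeightedBound w T k a u → ∃ C : ℝ, ∀ x ∈ S, ‖u (x + v x)‖ ≤ C * w x ^ a := by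
    intro a V _ _ u k hu
    obtain ⟨C, hC0, hC⟩ := hu.bound_nonneg hwT
    have hpow : ∃ K : ℝ, ∀ x ∈ S, w (x + v x) ^ a ≤ K * w x ^ a := by
      -- Nonnegative powers need the upper comparison with d, negative powers the lower one with c.
      rcases a with a | a
      · refine ⟨d ^ a, fun x hx => ?_⟩
        simp only [Int.ofNat_eq_natCast, zpow_natCast]
        rw [← mul_pow]
        exact pow_le_pow_left₀ (hwT _ (hST x hx)).le (hwd x hx) a
      · refine ⟨(c ^ (a + 1))⁻¹, fun x hx => ?_⟩
        rw [zpow_negSucc, zpow_negSucc, ← mul_inv, ← mul_pow]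
        exact inv_anti₀ (pow_pos (mul_pos hc (hw x hx)) _)
          (pow_le_pow_left₀ (mul_pos hc (hw x hx)).le (hcw x hx) _)
    obtain ⟨K, hK⟩ := hpow
    refine ⟨C * K, fun x hx => (hC _ (hST x hx)).trans ?_⟩
    rw [mul_assoc]
    exact mul_le_mul_of_nonneg_left (hK x hx) hC0
  induction k with
  | zero => intro a V _ _ u _ hu; exact key hu
  | succ k ih =>
    intro a V _ _ u hv hu
    have hd : ∀ x ∈ S, HasFDerivAt (fun x => u (x + v x))
        (fderiv ℝ u (x + v x) + (fderiv ℝ u (x + v x)).comp (fderiv ℝ v x)) x := by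
      intro x hx
      have h1 : HasFDerivAt (fun x => x + v x) (ContinuousLinearMap.id ℝ E + fderiv ℝ v x) x :=
        (hasFDerivAt_id x).add (hv.2.1 x hx).hasFDerivAt
      have h2 := (hu.2.1 _ (hST x hx)).hasFDerivAt.comp x h1
      rwa [ContinuousLinearMap.comp_add, ContinuousLinearMap.comp_id] at h2
    refine ⟨key hu, fun x hx => (hd x hx).differentiableAt, ?_⟩
    have h1 := ih hv.of_succ hu.2.2
    have h2 := bilinear hw hS (ContinuousLinearMap.compL ℝ E E V) h1 hv.2.2
    rw [show a - 1 + (1 - 1) = a - 1 by ring] at h2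
    exact (h1.add hS h2).congr hS fun x hx => (hd x hx).fderiv

/-- The mean value inequality bounds the difference by |Du||v|, a gain of b - 1 powers over the
composition alone. It spends one derivative of u, hence order k + 1 there, and needs w to be
comparable along the whole segment. -/
theorem comp_id_add_sub (hw : ∀ x ∈ S, 0 < w x) (hw1 : ∀ x ∈ S, w x ≤ 1) (hS : IsOpen S)
    {T : Set E} (hwT : ∀ x ∈ T, 0 < w x) {v : E → E}
    (hST : ∀ x ∈ S, ∀ t ∈ Set.Icc (0 : ℝ) 1, x + t • v x ∈ T) {c d : ℝ} (hc : 0 < c)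
    (hcw : ∀ x ∈ S, ∀ t ∈ Set.Icc (0 : ℝ) 1, c * w x ≤ w (x + t • v x))
    (hwd : ∀ x ∈ S, ∀ t ∈ Set.Icc (0 : ℝ) 1, w (x + t • v x) ≤ d * w x) {k : ℕ} :
    ∀ {a b : ℤ} (_ : 1 ≤ b) {V : Type} [NormedAddCommGroup V] [NormedSpace ℝ V] {u : E → V},
      WeightedBound w S k b v → WeightedBound w T (k + 1) a u →
      WeightedBound w S k (a + b - 1) (fun x => u (x + v x) - u x) := by
  have key : ∀ {a b : ℤ} {V : Type} [NormedAddCommGroup V] [NormedSpace ℝ V] {u : E → V} {k : ℕ},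
      WeightedBound w S k b v → WeightedBound w T (k + 1) a u →
      ∃ C : ℝ, ∀ x ∈ S, ‖u (x + v x) - u x‖ ≤ C * w x ^ (a + b - 1) := by
    intro a b V _ _ u k hv hu
    obtain ⟨C, hC0, hC⟩ := hu.2.2.bound_nonneg hwT
    obtain ⟨D, hD⟩ := hv.bound
    have hpow : ∃ K : ℝ, 0 ≤ K ∧ ∀ x ∈ S, ∀ t ∈ Set.Icc (0 : ℝ) 1,
        w (x + t • v x) ^ (a - 1) ≤ K * w x ^ (a - 1) := by
      rcases a - 1 with a | a
      · refine ⟨|d| ^ a, by positivity, fun x hx t ht => ?_⟩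
        simp only [Int.ofNat_eq_natCast, zpow_natCast]
        rw [← mul_pow]
        exact pow_le_pow_left₀ (hwT _ (hST x hx t ht)).le ((hwd x hx t ht).trans
          (mul_le_mul_of_nonneg_right (le_abs_self d) (hw x hx).le)) a
      · refine ⟨(c ^ (a + 1))⁻¹, by positivity, fun x hx t ht => ?_⟩
        rw [zpow_negSucc, zpow_negSucc, ← mul_inv, ← mul_pow]
        exact inv_anti₀ (pow_pos (mul_pos hc (hw x hx)) _)
          (pow_le_pow_left₀ (mul_pos hc (hw x hx)).le (hcw x hx t ht) _)
    obtain ⟨K, hK0, hK⟩ := hpow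
    refine ⟨C * K * D, fun x hx => ?_⟩
    have hseg : ∀ y ∈ segment ℝ x (x + v x), ∃ t ∈ Set.Icc (0 : ℝ) 1, y = x + t • v x := by
      intro y hy
      rw [segment_eq_image'] at hy
      obtain ⟨t, ht, rfl⟩ := hy
      exact ⟨t, ht, by simp⟩
    have hmv := (convex_segment x (x + v x)).norm_image_sub_le_of_norm_fderiv_le (𝕜 := ℝ) (f := u)
      (C := C * (K * w x ^ (a - 1))) (fun y hy => by
        obtain ⟨t, ht, rfl⟩ := hseg y hy
        exact hu.2.1 _ (hST x hx t ht)) (fun y hy => by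
        obtain ⟨t, ht, rfl⟩ := hseg y hy
        exact (hC _ (hST x hx t ht)).trans (mul_le_mul_of_nonneg_left (hK x hx t ht) hC0))
      (left_mem_segment ℝ _ _) (right_mem_segment ℝ _ _)
    refine hmv.trans ?_
    rw [add_sub_cancel_left]
    calc C * (K * w x ^ (a - 1)) * ‖v x‖ ≤ C * (K * w x ^ (a - 1)) * (D * w x ^ b) :=
          mul_le_mul_of_nonneg_left (hD x hx)
            (mul_nonneg hC0 (mul_nonneg hK0 (zpow_nonneg (hw x hx).le _)))
      _ = C * K * D * w x ^ (a + b - 1) := by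
          rw [show a + b - 1 = (a - 1) + b by ring, zpow_add₀ (hw x hx).ne']; ring
  have h0 : (0 : ℝ) ∈ Set.Icc (0 : ℝ) 1 := by simp
  have h1 : (1 : ℝ) ∈ Set.Icc (0 : ℝ) 1 := by simp
  have hS0 : ∀ x ∈ S, x ∈ T := fun x hx => by simpa using hST x hx 0 h0
  have hS1 : ∀ x ∈ S, x + v x ∈ T := fun x hx => by simpa using hST x hx 1 h1
  induction k with
  | zero => intro a b _ V _ _ u hv hu; exact key hv hu
  | succ k ih =>
    intro a b hb V _ _ u hv hu
    have hd : ∀ x ∈ S, HasFDerivAt (fun x => u (x + v x) - u x)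
        ((fderiv ℝ u (x + v x) - fderiv ℝ u x)
          + (fderiv ℝ u (x + v x)).comp (fderiv ℝ v x)) x := by
      intro x hx
      have h1 : HasFDerivAt (fun x => x + v x) (ContinuousLinearMap.id ℝ E + fderiv ℝ v x) x :=
        (hasFDerivAt_id x).add (hv.2.1 x hx).hasFDerivAt
      have h2 := ((hu.2.1 _ (hS1 x hx)).hasFDerivAt.comp x h1).sub
        (hu.2.1 _ (hS0 x hx)).hasFDerivAt
      rwa [ContinuousLinearMap.comp_add, ContinuousLinearMap.comp_id, add_sub_right_comm] at h2
    refine ⟨key hv hu, fun x hx => (hd x hx).differentiableAt, ?_⟩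
    have h2 := ih hb hv.of_succ hu.2.2
    have h3 := comp_id_add hw hS hwT hS1 hc
      (fun x hx => by simpa using hcw x hx 1 h1) (fun x hx => by simpa using hwd x hx 1 h1)
      ((hv.of_succ).mono_exp hw hw1 hb) hu.2.2.of_succ
    have h4 := bilinear hw hS (ContinuousLinearMap.compL ℝ E E V) h3 hv.2.2
    rw [show a - 1 + (b - 1) = a + b - 1 - 1 by ring] at h4
    rw [show a - 1 + b - 1 = a + b - 1 - 1 by ring] at h2
    exact (h2.add hS h4).congr hS fun x hx => (hd x hx).fderiv

end WeightedBound

/-! ### Regularity across the zero set, and sources of weighted bounds -/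

namespace WeightedBound

variable {E : Type} [NormedAddCommGroup E] [NormedSpace ℝ E]

/-- A Lipschitz weight is at most L times the distance to any of its zeros, so powers of w become
powers of that distance. -/
theorem isBigO_pow {w : E → ℝ} {B : Set E} (hB : IsOpen B) (hw0 : ∀ x ∈ B, 0 ≤ w x)
    (hw1 : ∀ x ∈ B, w x ≤ 1) {L : ℝ} (hL : ∀ x ∈ B, ∀ z ∈ B, w z = 0 → w x ≤ L * ‖x - z‖)
    {V : Type} [NormedAddCommGroup V] [NormedSpace ℝ V] {a : ℤ} {b k : ℕ} (hab : (b : ℤ) ≤ a)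
    {u : E → V} (hu : WeightedBound w {x ∈ B | 0 < w x} k a u)
    (hu0 : ∀ z ∈ B, w z = 0 → u z = 0) (hb : b ≠ 0) {z : E} (hz : z ∈ B) (hwz : w z = 0) :
    u =O[𝓝 z] fun x => ‖x - z‖ ^ b := by
  obtain ⟨C, hC0, hC⟩ := hu.bound_nonneg (fun x hx => hx.2)
  refine Asymptotics.IsBigO.of_bound (C * L ^ b)
    (Filter.eventually_of_mem (hB.mem_nhds hz) fun x hx => ?_)
  have h1 : ‖u x‖ ≤ C * w x ^ b := by
    rcases (hw0 x hx).eq_or_lt with h | h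
    · simp [hu0 x hx h.symm, ← h, hb]
    · refine (hC x ⟨hx, h⟩).trans (mul_le_mul_of_nonneg_left ?_ hC0)
      rw [← zpow_natCast]
      exact zpow_le_zpow_right_of_le_one₀ h (hw1 x hx) hab
  refine h1.trans ?_
  rw [norm_pow, norm_norm, mul_assoc, ← mul_pow]
  exact mul_le_mul_of_nonneg_left (pow_le_pow_left₀ (hw0 x hx) (hL x hx z hz hwz) _) hC0

/-- A weighted bound of exponent larger than the order makes `u` regular across the zero set
of `w`. -/
theorem contDiffOn {w : E → ℝ} {B : Set E} (hB : IsOpen B) (hw0 : ∀ x ∈ B, 0 ≤ w x)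
    (hw1 : ∀ x ∈ B, w x ≤ 1) {L : ℝ} (hL : ∀ x ∈ B, ∀ z ∈ B, w z = 0 → w x ≤ L * ‖x - z‖)
    (hS : IsOpen {x ∈ B | 0 < w x}) {k : ℕ} :
    ∀ {a : ℤ} (_ : (k : ℤ) + 1 ≤ a) {V : Type} [NormedAddCommGroup V] [NormedSpace ℝ V]
      {u : E → V}, WeightedBound w {x ∈ B | 0 < w x} k a u →
      ContDiffOn ℝ k u {x ∈ B | 0 < w x} → (∀ z ∈ B, w z = 0 → u z = 0) →
      ContDiffOn ℝ k u B := by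
  have hcase : ∀ x ∈ B, w x = 0 ∨ x ∈ {x ∈ B | 0 < w x} := fun x hx =>
    (hw0 x hx).eq_or_lt.imp Eq.symm fun h => ⟨hx, h⟩
  induction k with
  | zero =>
    intro a ha V _ _ u hu hc hu0
    simp only [Nat.cast_zero, contDiffOn_zero] at hc ⊢
    intro x hx
    refine ContinuousAt.continuousWithinAt ?_
    rcases hcase x hx with h | h
    · have h1 := isBigO_pow hB hw0 hw1 hL (b := 1) (by simpa using ha) hu hu0 one_ne_zero hx h
      have h2 : Filter.Tendsto (fun y => ‖y - x‖ ^ 1) (𝓝 x) (𝓝 0) := by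
        have : Continuous fun y => ‖y - x‖ ^ 1 := by fun_prop
        simpa using this.tendsto x
      rw [ContinuousAt, hu0 x hx h]
      exact h1.trans_tendsto h2
    · exact hc.continuousAt (hS.mem_nhds h)
  | succ k ih =>
    intro a ha V _ _ u hu hc hu0
    -- Here a ≥ 2, so u = O(|x - z|²) and Du vanishes at z. Thus Du satisfies the same hypotheses
    -- with order and exponent lowered by one.
    have hz : ∀ z ∈ B, w z = 0 → HasFDerivAt u (0 : E →L[ℝ] V) z := fun z hz hwz =>
      (isBigO_pow hB hw0 hw1 hL (b := 2) (by push_cast at ha ⊢; omega) hu hu0 two_ne_zero hz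
        hwz).hasFDerivAt (by norm_num)
    have hc' : ContDiffOn ℝ ((k : WithTop ℕ∞) + 1) u {x ∈ B | 0 < w x} := by exact_mod_cast hc
    rw [contDiffOn_succ_iff_fderiv_of_isOpen hS] at hc'
    have : ContDiffOn ℝ ((k : WithTop ℕ∞) + 1) u B := by
      rw [contDiffOn_succ_iff_fderiv_of_isOpen hB]
      refine ⟨fun x hx => ?_, by simp, ih (a := a - 1) (by push_cast at ha ⊢; omega) hu.2.2 hc'.2.2
        fun z hz0 hwz => (hz z hz0 hwz).fderiv⟩
      rcases hcase x hx with h | h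
      · exact (hz x hx h).differentiableAt.differentiableWithinAt
      · exact (hu.2.1 x h).differentiableWithinAt
    exact_mod_cast this

/-- Exponent 0 suffices because w ≤ 1 makes w^(-j) ≥ 1: bounded derivatives satisfy the weaker
bounds with negative exponents. The neighbourhood is chosen before w and S, so it does not depend on
them. -/
theorem of_contDiffAt {x₀ : E} {k : ℕ} : ∀ {V : Type} [NormedAddCommGroup V] [NormedSpace ℝ V]
    {u : E → V}, ContDiffAt ℝ k u x₀ → ∃ N ∈ 𝓝 x₀, ∀ (w : E → ℝ) (S : Set E), S ⊆ N →
      (∀ x ∈ S, 0 < w x) → (∀ x ∈ S, w x ≤ 1) → WeightedBound w S k 0 u := by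
  have key : ∀ {V : Type} [NormedAddCommGroup V] {u : E → V}, ContinuousAt u x₀ →
      ∃ N ∈ 𝓝 x₀, ∀ x ∈ N, ‖u x‖ ≤ ‖u x₀‖ + 1 := by
    intro V _ u hu
    exact ⟨_, hu.norm.eventually_le_const (lt_add_one _), fun x hx => hx⟩
  induction k with
  | zero =>
    intro V _ _ u hu
    obtain ⟨N, hN, hb⟩ := key hu.continuousAt
    exact ⟨N, hN, fun w S hS _ _ => ⟨‖u x₀‖ + 1, fun x hx => by simpa using hb x (hS hx)⟩⟩
  | succ k ih =>
    intro V _ _ u hu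
    obtain ⟨N, hN, hb⟩ := key hu.continuousAt
    have hu' : ContDiffAt ℝ ((k : WithTop ℕ∞) + 1) u x₀ := by exact_mod_cast hu
    obtain ⟨M, hM, hD⟩ := ih hu'.fderiv_right_succ
    have hd : ∀ᶠ x in 𝓝 x₀, DifferentiableAt ℝ u x := by
      filter_upwards [hu.eventually (by simp)] with x hx
      exact hx.differentiableAt (by simp)
    refine ⟨N ∩ M ∩ {x | DifferentiableAt ℝ u x},
      Filter.inter_mem (Filter.inter_mem hN hM) hd, fun w S hS hw hw1 =>
        ⟨⟨‖u x₀‖ + 1, fun x hx => by simpa using hb x (hS hx).1.1⟩, fun x hx => (hS hx).2, ?_⟩⟩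
    exact (hD w S (fun x hx => (hS hx).1.2) hw hw1).mono_exp hw hw1 (by norm_num)

theorem zero {w : E → ℝ} {S : Set E} {k : ℕ} : ∀ {a : ℤ} {V : Type} [NormedAddCommGroup V]
    [NormedSpace ℝ V], WeightedBound w S k a (fun _ : E => (0 : V)) := by
  induction k with
  | zero => intro a V _ _; exact ⟨0, by simp⟩
  | succ k ih =>
    intro a V _ _
    refine ⟨⟨0, by simp⟩, fun x _ => differentiableAt_const _, ?_⟩
    rw [fderiv_fun_const]
    exact ih

theorem sum {w : E → ℝ} {S : Set E} (hS : IsOpen S) {V : Type} [NormedAddCommGroup V]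
    [NormedSpace ℝ V] {k : ℕ} {a : ℤ} {ι : Type} (s : Finset ι) {u : ι → E → V}
    (hu : ∀ i, WeightedBound w S k a (u i)) : WeightedBound w S k a (fun x => ∑ i ∈ s, u i x) := by
  classical
  induction s using Finset.induction_on with
  | empty => simpa using zero
  | insert i s hi ih =>
    simp only [Finset.sum_insert hi]
    exact (hu i).add hS ih

end WeightedBound

/-! ### From multi-index partial derivatives to Fréchet derivatives -/

section PartialDerivatives

variable {n : ℕ} {B : Set (EuclideanSpace ℝ (Fin n))}

/-- The iterated partial derivative along a list of coordinate indices. -/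
noncomputable def wordDeriv (l : List (Fin n)) (u : EuclideanSpace ℝ (Fin n) → ℝ) :
    EuclideanSpace ℝ (Fin n) → ℝ :=
  l.foldr partialDeriv u

theorem partialDeriv_eq_fderiv (i : Fin n) {u : EuclideanSpace ℝ (Fin n) → ℝ}
    {x : EuclideanSpace ℝ (Fin n)} (hu : DifferentiableAt ℝ u x) :
    partialDeriv i u x = fderiv ℝ u x (EuclideanSpace.single i 1) :=
  hu.lineDeriv_eq_fderiv

theorem multiPartialDeriv_eq_wordDeriv (m : Fin n → ℕ) (u : EuclideanSpace ℝ (Fin n) → ℝ) :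
    multiPartialDeriv m u =
      wordDeriv ((List.finRange n).flatMap fun i => List.replicate (m i) i) u := by
  have hrep : ∀ (k : ℕ) (i : Fin n) (v : EuclideanSpace ℝ (Fin n) → ℝ),
      (List.replicate k i).foldr partialDeriv v = (partialDeriv i)^[k] v := by
    intro k i v
    induction k with
    | zero => rfl
    | succ k ih => rw [List.replicate_succ, List.foldr_cons, ih, Function.iterate_succ_apply']
  unfold multiPartialDeriv wordDeriv
  induction List.finRange n with
  | nil => rfl
  | cons i l ih => rw [List.foldr_cons, List.flatMap_cons, List.foldr_append, ih, hrep]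

theorem partialDeriv_congr (hB : IsOpen B) (i : Fin n) {u v : EuclideanSpace ℝ (Fin n) → ℝ}
    (huv : Set.EqOn u v B) : Set.EqOn (partialDeriv i u) (partialDeriv i v) B := fun _ hx =>
  Filter.EventuallyEq.lineDeriv_eq (Filter.eventually_of_mem (hB.mem_nhds hx) huv)

theorem ContDiffOn.partialDeriv (hB : IsOpen B) {k : ℕ} (i : Fin n)
    {u : EuclideanSpace ℝ (Fin n) → ℝ} (hu : ContDiffOn ℝ (k + 1 : ℕ) u B) :
    ContDiffOn ℝ k (partialDeriv i u) B := by
  have hu' : ContDiffOn ℝ ((k : WithTop ℕ∞) + 1) u B := by exact_mod_cast hu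
  rw [contDiffOn_succ_iff_fderiv_of_isOpen hB] at hu'
  exact (hu'.2.2.clm_apply contDiffOn_const).congr fun x hx =>
    partialDeriv_eq_fderiv i (hu'.1.differentiableAt (hB.mem_nhds hx))

theorem ContDiffOn.wordDeriv (hB : IsOpen B) {k : ℕ} (l : List (Fin n))
    {u : EuclideanSpace ℝ (Fin n) → ℝ} (hu : ContDiffOn ℝ (k + l.length : ℕ) u B) :
    ContDiffOn ℝ k (wordDeriv l u) B := by
  induction l generalizing k with
  | nil => exact hu
  | cons i l ih =>
    refine ContDiffOn.partialDeriv hB i (ih ?_)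
    rwa [List.length_cons, ← add_assoc, add_right_comm] at hu

theorem partialDeriv_comm (hB : IsOpen B) (i j : Fin n) {u : EuclideanSpace ℝ (Fin n) → ℝ}
    (hu : ContDiffOn ℝ (2 : ℕ) u B) :
    Set.EqOn (partialDeriv i (partialDeriv j u)) (partialDeriv j (partialDeriv i u)) B := by
  intro x hx
  have hd : ∀ y ∈ B, DifferentiableAt ℝ u y := fun y hy =>
    (hu.contDiffAt (hB.mem_nhds hy)).differentiableAt (by simp)
  have hd2 : DifferentiableAt ℝ (fderiv ℝ u) x :=
    ((hu.contDiffAt (hB.mem_nhds hx)).fderiv_right (m := 1)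
      (by norm_num [one_add_one_eq_two])).differentiableAt (by simp)
  have key : ∀ i j : Fin n, partialDeriv i (partialDeriv j u) x
      = fderiv ℝ (fderiv ℝ u) x (EuclideanSpace.single i 1) (EuclideanSpace.single j 1) := by
    intro i j
    have h1 : Set.EqOn (partialDeriv j u) (fun y => fderiv ℝ u y (EuclideanSpace.single j 1)) B :=
      fun y hy => partialDeriv_eq_fderiv j (hd y hy)
    have h2 := hd2.hasFDerivAt.clm_apply
      (hasFDerivAt_const (EuclideanSpace.single j (1 : ℝ)) x)
    rw [partialDeriv_congr hB i h1 hx, partialDeriv_eq_fderiv i h2.differentiableAt, h2.fderiv]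
    simp
  rw [key, key]
  exact (hu.contDiffAt (hB.mem_nhds hx)).isSymmSndFDerivAt (by simp) _ _

theorem wordDeriv_perm (hB : IsOpen B) {l l' : List (Fin n)} (hl : l.Perm l')
    {u : EuclideanSpace ℝ (Fin n) → ℝ} (hu : ContDiffOn ℝ l.length u B) :
    Set.EqOn (wordDeriv l u) (wordDeriv l' u) B := by
  induction hl with
  | nil => exact fun _ _ => rfl
  | cons i _ ih => exact partialDeriv_congr hB i (ih (hu.of_le (by simp)))
  | swap i j l =>
    refine partialDeriv_comm hB j i (ContDiffOn.wordDeriv hB l ?_)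
    rw [show 2 + l.length = (j :: i :: l).length by simp; omega]
    exact hu
  | trans h _ ih ih' => exact (ih hu).trans (ih' (by rwa [← h.length_eq]))

/-- By symmetry of second derivatives only the letter counts matter, so bounds assumed for ordered
multi-indices apply to every word. Arbitrary words are what iterating `fderiv` produces. -/
theorem wordDeriv_eq_multiPartialDeriv (hB : IsOpen B) (l : List (Fin n))
    {u : EuclideanSpace ℝ (Fin n) → ℝ} (hu : ContDiffOn ℝ l.length u B) :
    Set.EqOn (wordDeriv l u) (multiPartialDeriv (fun i => l.count i) u) B := by
  rw [multiPartialDeriv_eq_wordDeriv]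
  refine wordDeriv_perm hB (List.perm_iff_count.2 fun i => ?_) hu
  rw [List.count_flatMap, List.sum_map_eq_nsmul_single i]
  · simp [List.count_eq_one_of_mem (List.nodup_finRange n) (List.mem_finRange i)]
  · intro j hj _
    simp [List.count_replicate, hj]

theorem fderiv_eq_sum_partialDeriv {u : EuclideanSpace ℝ (Fin n) → ℝ}
    {x : EuclideanSpace ℝ (Fin n)} (hu : DifferentiableAt ℝ u x) :
    fderiv ℝ u x = ∑ i, partialDeriv i u x • (EuclideanSpace.proj i : _ →L[ℝ] ℝ) := by
  ext y
  conv_lhs => rw [← (EuclideanSpace.basisFun (Fin n) ℝ).sum_repr y]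
  simp [partialDeriv_eq_fderiv _ hu, mul_comm]

theorem WeightedBound.of_wordDeriv {w : EuclideanSpace ℝ (Fin n) → ℝ} {S : Set _}
    (hB : IsOpen B) (hS : IsOpen S) (hSB : S ⊆ B) {k : ℕ} :
    ∀ {a : ℤ} {u : EuclideanSpace ℝ (Fin n) → ℝ}, ContDiffOn ℝ k u B →
      (∀ l : List (Fin n), l.length ≤ k →
        ∃ C : ℝ, ∀ x ∈ S, ‖wordDeriv l u x‖ ≤ C * w x ^ (a - l.length)) →
      WeightedBound w S k a u := by
  induction k with
  | zero =>
    intro a u _ h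
    simpa [wordDeriv, WeightedBound] using h [] le_rfl
  | succ k ih =>
    intro a u hu h
    have hd : ∀ x ∈ S, DifferentiableAt ℝ u x := fun x hx =>
      (hu.contDiffAt (hB.mem_nhds (hSB hx))).differentiableAt (by simp)
    refine ⟨by simpa [wordDeriv] using h [] (by simp), hd, ?_⟩
    have hi : ∀ i, WeightedBound w S k (a - 1) (partialDeriv i u) := by
      intro i
      refine ih (hu.partialDeriv hB i) fun l hl => ?_
      -- The last letter of a word is the derivative applied first.
      obtain ⟨C, hC⟩ := h (l ++ [i]) (by simpa using hl)
      refine ⟨C, fun x hx => ?_⟩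
      have := hC x hx
      rw [show a - ((l ++ [i]).length : ℤ) = a - 1 - l.length by simp; ring] at this
      simpa [wordDeriv] using this
    refine (WeightedBound.sum hS Finset.univ fun i =>
      (hi i).clm_apply hS (ContinuousLinearMap.toSpanSingleton ℝ
        (EuclideanSpace.proj i : EuclideanSpace ℝ (Fin n) →L[ℝ] ℝ))).congr hS fun x hx => ?_
    simpa using fderiv_eq_sum_partialDeriv (hd x hx)

end PartialDerivatives

/-! ### The scalar equation: bounds, existence and regularity of its root -/

/-- With φ = id + sN and q = Dg(φ)N, differentiating g ∘ φ = f gives q Ds = -(Dg(φ) - Dg) - (Dg -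
Df) - s Dg(φ)∘DN. At order k every term on the right has exponent p + 2 and 1/q has exponent -2, so
Ds has exponent p: bounds on s at order k yield order k + 1. -/
theorem WeightedBound.of_apply_add_smul_eq {E : Type} [NormedAddCommGroup E] [NormedSpace ℝ E]
    {w : E → ℝ} {S T : Set E} (hw : ∀ x ∈ S, 0 < w x) (hw1 : ∀ x ∈ S, w x ≤ 1) (hS : IsOpen S)
    (hwT : ∀ x ∈ T, 0 < w x) {f g s : E → ℝ} {N : E → E} {p : ℕ}
    (hST : ∀ x ∈ S, ∀ t ∈ Set.Icc (0 : ℝ) 1, x + t • s x • N x ∈ T) {c d : ℝ} (hc : 0 < c)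
    (hcw : ∀ x ∈ S, ∀ t ∈ Set.Icc (0 : ℝ) 1, c * w x ≤ w (x + t • s x • N x))
    (hwd : ∀ x ∈ S, ∀ t ∈ Set.Icc (0 : ℝ) 1, w (x + t • s x • N x) ≤ d * w x)
    (hN : WeightedBound w S (p + 1) 1 N) (hg : WeightedBound w T (p + 1) 1 (fderiv ℝ g))
    (hgf : WeightedBound w S p (p + 2) (fun x => fderiv ℝ g x - fderiv ℝ f x))
    (hgd : ∀ x ∈ T, DifferentiableAt ℝ g x)
    (hs : ∃ C : ℝ, ∀ x ∈ S, ‖s x‖ ≤ C * w x ^ ((p : ℤ) + 1))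
    (hsd : ∀ x ∈ S, DifferentiableAt ℝ s x) (heq : ∀ x ∈ S, g (x + s x • N x) = f x)
    {e : ℝ} (he : 0 < e) (hq : ∀ x ∈ S, e * w x ^ 2 ≤ fderiv ℝ g (x + s x • N x) (N x)) {k : ℕ}
    (hk : k ≤ p + 1) : WeightedBound w S k (p + 1) s := by
  have hone : (1 : ℝ) ∈ Set.Icc (0 : ℝ) 1 := by simp
  have hS1 : ∀ x ∈ S, x + s x • N x ∈ T := fun x hx => by simpa using hST x hx 1 hone
  induction k with
  | zero => exact hs
  | succ k ih =>
    have hsk := ih (by omega)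
    have hkp : k ≤ p := by omega
    have hv : WeightedBound w S k (p + 2) (fun x => s x • N x) := by
      have := hsk.smul hw hS (hN.of_le (by omega))
      rwa [add_assoc, one_add_one_eq_two] at this
    have hgφ : WeightedBound w S k 1 (fun x => fderiv ℝ g (x + s x • N x)) :=
      comp_id_add hw hS hwT hS1 hc (fun x hx => by simpa using hcw x hx 1 hone)
        (fun x hx => by simpa using hwd x hx 1 hone) (hv.mono_exp hw hw1 (by omega))
        (hg.of_le (by omega))
    -- The mean value gain: v has exponent p + 2 and Dg has exponent 1, and k ≤ p leaves the extra
    -- derivative of Dg that is needed.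
    have hdiff : WeightedBound w S k (p + 2)
        (fun x => fderiv ℝ g (x + s x • N x) - fderiv ℝ g x) := by
      have := comp_id_add_sub hw hw1 hS hwT hST hc hcw hwd (by omega) hv
        (hg.of_le (Nat.succ_le_succ hkp))
      rwa [show (1 : ℤ) + (p + 2) - 1 = p + 2 by ring] at this
    have hsDN : WeightedBound w S k (p + 2)
        (fun x => s x • (fderiv ℝ g (x + s x • N x)).comp (fderiv ℝ N x)) := by
      have := hsk.smul hw hS (bilinear hw hS (ContinuousLinearMap.compL ℝ E E ℝ) hgφ
        (hN.2.2.of_le hkp))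
      rwa [show (p : ℤ) + 1 + (1 + (1 - 1)) = p + 2 by ring] at this
    have hqk : WeightedBound w S k 2 (fun x => fderiv ℝ g (x + s x • N x) (N x)) := by
      have := bilinear hw hS (ContinuousLinearMap.id ℝ (E →L[ℝ] ℝ)) hgφ
        (hN.of_le (show k ≤ p + 1 by omega))
      rwa [one_add_one_eq_two] at this
    have hqinv := inv hw hS he (fun x hx => by
      rw [show (2 : ℤ) = (2 : ℕ) by rfl, zpow_natCast]
      exact (hq x hx).trans (le_abs_self _)) hqk
    have hfin := hqinv.smul hw hS ((((hdiff.neg hS).sub hS (hgf.of_le hkp))).sub hS hsDN)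
    rw [show -2 + ((p : ℤ) + 2) = p + 1 - 1 by ring] at hfin
    refine ⟨hs, hsd, hfin.congr hS fun x hx => ?_⟩
    have hφ : HasFDerivAt (fun y => y + s y • N y) (ContinuousLinearMap.id ℝ E +
        (s x • fderiv ℝ N x + (fderiv ℝ s x).smulRight (N x))) x :=
      (hasFDerivAt_id x).add ((hsd x hx).hasFDerivAt.smul (hN.2.1 x hx).hasFDerivAt)
    have h1 := (hgd _ (hS1 x hx)).hasFDerivAt.comp x hφ
    have h2 : fderiv ℝ f x = _ := (h1.congr_of_eventuallyEq
      (Filter.eventually_of_mem (hS.mem_nhds hx) fun y hy => (heq y hy).symm)).fderiv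
    have hqne : fderiv ℝ g (x + s x • N x) (N x) ≠ 0 :=
      ((mul_pos he (pow_pos (hw x hx) 2)).trans_le (hq x hx)).ne'
    ext y
    have h3 := congrArg (fun A : E →L[ℝ] ℝ => A y) h2
    simp only [ContinuousLinearMap.comp_apply, add_apply, map_add,
      ContinuousLinearMap.id_apply, smul_apply, map_smul, smul_eq_mul,
      ContinuousLinearMap.smulRight_apply] at h3
    simp only [smul_apply, sub_apply,
      neg_apply, ContinuousLinearMap.comp_apply, smul_eq_mul, h3]
    field_simp
    ring

/-- Slope at least m forces a sign change within distance |G 0|/m ≤ b and makes G strictly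
increasing. Uniqueness on the larger interval [-ε, ε] later identifies the root with the implicit
function. -/
theorem exists_root_of_le_deriv {G : ℝ → ℝ} {ε m b : ℝ} (hm : 0 < m) (hbε : b ≤ ε)
    (hd : ∀ t ∈ Set.Icc (-ε) ε, DifferentiableAt ℝ G t)
    (hG : ∀ t ∈ Set.Icc (-ε) ε, m ≤ deriv G t) (hb : |G 0| ≤ m * b) :
    ∃ t, |t| ≤ b ∧ G t = 0 ∧ ∀ t' ∈ Set.Icc (-ε) ε, G t' = 0 → t' = t := by
  have hb0 : 0 ≤ b := nonneg_of_mul_nonneg_right ((abs_nonneg _).trans hb) hm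
  have hinc : ∀ x ∈ Set.Icc (-ε) ε, ∀ y ∈ Set.Icc (-ε) ε, x ≤ y → m * (y - x) ≤ G y - G x :=
    (convex_Icc _ _).mul_sub_le_image_sub_of_le_deriv
      (fun t ht => (hd t ht).continuousAt.continuousWithinAt)
      (fun t ht => (hd t (interior_subset ht)).differentiableWithinAt)
      (fun t ht => hG t (interior_subset ht))
  have h0 : (0 : ℝ) ∈ Set.Icc (-ε) ε := ⟨by linarith, by linarith⟩
  have h1 := hinc 0 h0 b ⟨by linarith, hbε⟩ hb0
  have h2 := hinc (-b) ⟨by linarith, by linarith⟩ 0 h0 (by linarith)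
  have habs := abs_le.1 hb
  obtain ⟨t, ht, hGt⟩ := intermediate_value_Icc (show -b ≤ b by linarith)
    (fun t ht => (hd t ⟨by linarith [ht.1], by linarith [ht.2]⟩).continuousAt.continuousWithinAt)
    (show (0 : ℝ) ∈ Set.Icc (G (-b)) (G b) from ⟨by linarith, by linarith⟩)
  have htε : t ∈ Set.Icc (-ε) ε := ⟨by linarith [ht.1], by linarith [ht.2]⟩
  refine ⟨t, abs_le.2 ht, hGt, fun t' ht' hGt' => ?_⟩
  rcases le_total t t' with h | h
  · have := hinc t htε t' ht' h
    nlinarith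
  · have := hinc t' ht' t htε h
    nlinarith

/-- Local uniqueness of zeros forces s to agree near x with the implicit function, without
continuity of s being assumed. -/
theorem contDiffAt_of_eventually_unique {E : Type*} [NormedAddCommGroup E] [NormedSpace ℝ E]
    [CompleteSpace E] {G : E × ℝ → ℝ} {s : E → ℝ} {x : E} {n : WithTop ℕ∞} (hn : n ≠ 0)
    (hG : ContDiffAt ℝ n G (x, s x)) (h0 : G (x, s x) = 0)
    (hne : fderiv ℝ G (x, s x) (0, 1) ≠ 0)
    (huniq : ∀ᶠ q in 𝓝 (x, s x), G q = 0 → q.2 = s q.1) : ContDiffAt ℝ n s x := by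
  have hinv : (fderiv ℝ G (x, s x) ∘L .inr ℝ E ℝ).IsInvertible := by
    refine ⟨ContinuousLinearEquiv.unitsEquivAut ℝ (Units.mk0 _ hne), ?_⟩
    ext
    simp
  have hψ := hG.contDiffAt_implicitFunction hn hinv
  refine hψ.congr_of_eventuallyEq ?_
  have hlim : Filter.Tendsto (fun y => (y, hG.implicitFunction hn hinv y)) (𝓝 x)
      (𝓝 (x, s x)) := by
    have h1 := hψ.continuousAt.tendsto
    rw [hG.implicitFunction_apply_self hn hinv] at h1
    exact Filter.tendsto_id.prodMk_nhds h1
  filter_upwards [hlim.eventually huniq, hG.eventually_apply_implicitFunction hn hinv] with y h1 h2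
  exact (h1 (h2.trans h0)).symm

theorem natCast_ne_infty (k : ℕ) : (k : WithTop ℕ∞) ≠ (⊤ : ℕ∞) := by
  exact_mod_cast ENat.natCast_ne_top k

/-- The Riesz isomorphism as a real-linear map from functionals to vectors. -/
noncomputable def rieszVector (E : Type) [NormedAddCommGroup E] [InnerProductSpace ℝ E]
    [CompleteSpace E] : (E →L[ℝ] ℝ) →L[ℝ] E :=
  LinearMap.mkContinuous
    { toFun := (InnerProductSpace.toDual ℝ E).symm
      map_add' := fun A A' => map_add _ A A'
      map_smul' := fun c A => by simp } 1 (fun A => by simp)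

/-! ### Construction of the displacement -/

section

variable {E : Type} [NormedAddCommGroup E] [InnerProductSpace ℝ E] [CompleteSpace E]

theorem norm_rieszVector (A : E →L[ℝ] ℝ) : ‖rieszVector E A‖ = ‖A‖ :=
  (InnerProductSpace.toDual ℝ E).symm.norm_map A

theorem apply_rieszVector (A : E →L[ℝ] ℝ) : A (rieszVector E A) = ‖A‖ ^ 2 := by
  have h : inner ℝ (rieszVector E A) (rieszVector E A) = A (rieszVector E A) :=
    InnerProductSpace.toDual_symm_apply
  rw [← h, real_inner_self_eq_norm_sq, norm_rieszVector]

/-- Each of the two perturbations costs at most ‖A‖²/4 of the main term A(N) = ‖A‖². In use A, A', D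
are Df(x), Dg(x), Dg(x + tN). -/
theorem le_fderiv_add_smul_rieszVector {A A' D : E →L[ℝ] ℝ} (h1 : ‖A' - A‖ ≤ ‖A‖ / 4)
    (h2 : ‖D - A'‖ ≤ ‖A‖ / 4) : ‖A‖ ^ 2 / 2 ≤ D (rieszVector E A) := by
  have e : D (rieszVector E A) = ‖A‖ ^ 2 + (A' - A) (rieszVector E A)
      + (D - A') (rieszVector E A) := by
    rw [← apply_rieszVector A]; simp
  have b1 := (A' - A).le_opNorm (rieszVector E A)
  have b2 := (D - A').le_opNorm (rieszVector E A)
  rw [norm_rieszVector, Real.norm_eq_abs] at b1 b2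
  have c1 := mul_le_mul_of_nonneg_right h1 (norm_nonneg A)
  have c2 := mul_le_mul_of_nonneg_right h2 (norm_nonneg A)
  have d1 := (abs_le.1 (b1.trans c1)).1
  have d2 := (abs_le.1 (b2.trans c2)).1
  rw [e]
  linarith

theorem exists_displacement {f g : E → ℝ} {p : ℕ} (hf : ContDiffAt ℝ (p + 2 : ℕ) f 0)
    (hg : ContDiffAt ℝ (p + 2 : ℕ) g 0) (hf' : fderiv ℝ f 0 = 0) {U : Set E} (hU : U ∈ 𝓝 (0 : E))
    (hZ : ∀ x ∈ U, ‖fderiv ℝ f x‖ = 0 → g x = f x)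
    (hh : WeightedBound (fun x => ‖fderiv ℝ f x‖) {x ∈ U | 0 < ‖fderiv ℝ f x‖} (p + 1) (p + 3)
      (g - f)) :
    ∃ v : E → E, ContDiffAt ℝ (p + 1 : ℕ) v 0 ∧ v 0 = 0 ∧ HasFDerivAt v (0 : E →L[ℝ] E) 0 ∧
      ∀ᶠ x in 𝓝 0, f x = g (x + v x) := by
  set w : E → ℝ := fun x => ‖fderiv ℝ f x‖
  set N : E → E := fun x => rieszVector E (fderiv ℝ f x)
  have hNw : ∀ x, ‖N x‖ = w x := fun x => norm_rieszVector _
  have hDf : ContDiffAt ℝ (p + 1 : ℕ) (fderiv ℝ f) 0 :=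
    hf.fderiv_right (by norm_cast)
  have hDg : ContDiffAt ℝ (p + 1 : ℕ) (fderiv ℝ g) 0 :=
    hg.fderiv_right (by norm_cast)
  have hDN : ContDiffAt ℝ (p + 1 : ℕ) N 0 := (rieszVector E).contDiff.contDiffAt.comp 0 hDf
  obtain ⟨K₁, t₁, ht₁, hK₁⟩ := (hDf.of_le (by norm_cast; omega)).exists_lipschitzOnWith
  obtain ⟨K₂, t₂, ht₂, hK₂⟩ := (hDg.of_le (by norm_cast; omega)).exists_lipschitzOnWith
  obtain ⟨M₁, hM₁, hWN⟩ := WeightedBound.of_contDiffAt (k := p)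
    (hDN.fderiv_right (m := p) (by norm_cast))
  obtain ⟨M₂, hM₂, hWg⟩ := WeightedBound.of_contDiffAt (k := p)
    (hDg.fderiv_right (m := p) (by norm_cast))
  have hwc : ContinuousAt w 0 := hDf.continuousAt.norm
  have hw00 : w 0 = 0 := by simp [w, hf']
  have hwlt : ∀ η : ℝ, 0 < η → ∀ᶠ x in 𝓝 (0 : E), w x < η := fun η hη =>
    hwc.eventually_lt_const (by rwa [hw00])
  obtain ⟨ρ, hρ, hρN⟩ := Metric.eventually_nhds_iff_ball.1
    ((((Filter.Eventually.and (Filter.Eventually.and hU ht₁) (Filter.Eventually.and ht₂ hM₁)).and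
      (Filter.Eventually.and hM₂ (hwlt 1 one_pos))).and
      ((hf.eventually (natCast_ne_infty _)).and (hg.eventually (natCast_ne_infty _)))).and
      ((hDN.eventually (by simp)).and (hDf.eventually (by simp))))
  set T : Set E := {x ∈ Metric.ball (0 : E) ρ | 0 < w x}
  have hwcont : ∀ x ∈ Metric.ball (0 : E) ρ, ContinuousAt w x := fun x hx =>
    (hρN x hx).2.2.continuousAt.norm
  have hopen : ∀ δ ≤ ρ, IsOpen {x ∈ Metric.ball (0 : E) δ | 0 < w x} := by
    intro δ hδ
    have : ContinuousOn w (Metric.ball 0 δ) := fun x hx =>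
      (hwcont x (Metric.ball_subset_ball hδ hx)).continuousWithinAt
    exact this.isOpen_inter_preimage Metric.isOpen_ball isOpen_Ioi
  have hTo : IsOpen T := hopen ρ le_rfl
  have hwT : ∀ x ∈ T, 0 < w x := fun x hx => hx.2
  have hwT1 : ∀ x ∈ T, w x ≤ 1 := fun x hx => (hρN x hx.1).1.1.2.2.le
  have hfd : ∀ x ∈ Metric.ball (0 : E) ρ, DifferentiableAt ℝ f x := fun x hx =>
    (hρN x hx).1.2.1.differentiableAt (by simp)
  have hgd : ∀ x ∈ Metric.ball (0 : E) ρ, DifferentiableAt ℝ g x := fun x hx =>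
    (hρN x hx).1.2.2.differentiableAt (by simp)
  have hhT : WeightedBound w T (p + 1) (p + 3) (g - f) :=
    hh.mono_set (show T ⊆ {x ∈ U | 0 < w x} from
      fun x hx => ⟨(hρN x hx.1).1.1.1.1.1, hx.2⟩)
  have hgf : WeightedBound w T p (p + 2) (fun x => fderiv ℝ g x - fderiv ℝ f x) := by
    have := hhT.2.2
    rw [show (p : ℤ) + 3 - 1 = p + 2 by ring] at this
    refine this.congr hTo fun x hx => ?_
    exact (fderiv_sub (hgd x hx.1) (hfd x hx.1)).symm
  have hNW : WeightedBound w T (p + 1) 1 N := by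
    refine ⟨⟨1, fun x _ => by rw [hNw]; simp⟩,
      fun x hx => (hρN x hx.1).2.1.differentiableAt (by simp), ?_⟩
    exact hWN w T (fun x hx => (hρN x hx.1).1.1.1.2.2) hwT hwT1
  obtain ⟨C₀, hC₀, hC₀h⟩ := hhT.bound_nonneg hwT
  obtain ⟨C₁, hC₁, hC₁h⟩ := hgf.bound_nonneg hwT
  have hgf1 : ∀ x ∈ T, ‖fderiv ℝ g x - fderiv ℝ f x‖ ≤ C₁ * w x * w x := by
    intro x hx
    refine (hC₁h x hx).trans ?_
    rw [mul_assoc, ← sq, ← zpow_natCast]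
    exact mul_le_mul_of_nonneg_left (zpow_le_zpow_right_of_le_one₀ hx.2 (hwT1 x hx)
      (by push_cast; omega)) hC₁
  have hgW : WeightedBound w T (p + 1) 1 (fderiv ℝ g) := by
    refine ⟨⟨C₁ + 1, fun x hx => ?_⟩, fun x hx => ?_, ?_⟩
    · have h1 := norm_sub_norm_le (fderiv ℝ g x) (fderiv ℝ f x)
      have h2 : C₁ * w x * w x ≤ C₁ * w x :=
        mul_le_of_le_one_right (mul_nonneg hC₁ hx.2.le) (hwT1 x hx)
      have h3 := hgf1 x hx
      have h4 : ‖fderiv ℝ f x‖ = w x := rfl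
      rw [zpow_one]
      linarith
    · exact ((hρN x hx.1).1.2.2.fderiv_right (m := 1) (by norm_cast; omega)).differentiableAt
        (by simp)
    · exact hWg w T (fun x hx => (hρN x hx.1).1.1.2.1) hwT hwT1
  set K : ℝ := max (K₁ : ℝ) K₂ + 1
  have hK : 0 < K := by positivity
  -- For |t| ≤ ε the point moves by at most ε w, so the Lipschitz constant K changes Df and Dg by at
  -- most w/4; the bound ρ/2 keeps x + tN in the ball.
  set ε : ℝ := min (1 / (4 * K)) (ρ / 2)
  have hε : 0 < ε := by positivity
  have hKε : K * ε ≤ 1 / 4 := by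
    calc K * ε ≤ K * (1 / (4 * K)) := mul_le_mul_of_nonneg_left (min_le_left _ _) hK.le
      _ = 1 / 4 := by field_simp
  have hερ : ε ≤ ρ / 2 := min_le_right _ _
  -- The thresholds give C₁w ≤ 1/4, so Dg is within w/4 of Df, and 2C₀w ≤ ε/2, so the root lies well
  -- inside [-ε, ε].
  obtain ⟨δ', hδ', hδN⟩ := Metric.eventually_nhds_iff_ball.1
    ((hwlt (1 / (4 * (C₁ + 1))) (by positivity)).and (hwlt (ε / (4 * (C₀ + 1))) (by positivity)))
  set δ : ℝ := min δ' (ρ / 2)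
  have hδ : 0 < δ := by positivity
  have hδρ : δ ≤ ρ := (min_le_right _ _).trans (by linarith)
  have hBδ : Metric.ball (0 : E) δ ⊆ Metric.ball 0 ρ := Metric.ball_subset_ball hδρ
  set S : Set E := {x ∈ Metric.ball (0 : E) δ | 0 < w x}
  have hSo : IsOpen S := hopen δ hδρ
  have hST : S ⊆ T := fun x hx => ⟨hBδ hx.1, hx.2⟩
  have hw : ∀ x ∈ S, 0 < w x := fun x hx => hx.2
  have hw1 : ∀ x ∈ S, w x ≤ 1 := fun x hx => hwT1 x (hST hx)
  have hsmall₁ : ∀ x ∈ S, C₁ * w x ≤ 1 / 4 := by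
    intro x hx
    have h := (hδN x (Metric.ball_subset_ball (min_le_left _ _) hx.1)).1
    rw [lt_div_iff₀ (by positivity)] at h
    nlinarith [hw x hx]
  have hsmall₀ : ∀ x ∈ S, 2 * C₀ * w x ≤ ε / 2 := by
    intro x hx
    have h := (hδN x (Metric.ball_subset_ball (min_le_left _ _) hx.1)).2
    rw [lt_div_iff₀ (by positivity)] at h
    nlinarith [hw x hx]
  have hball : ∀ x ∈ S, ∀ t : ℝ, |t| ≤ ε → x + t • N x ∈ Metric.ball (0 : E) ρ := by
    intro x hx t ht
    have h1 : ‖x‖ < δ := by simpa using hx.1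
    have h2 : ‖t • N x‖ ≤ ε := by
      rw [norm_smul, hNw, Real.norm_eq_abs]
      exact (mul_le_of_le_one_right (abs_nonneg t) (hw1 x hx)).trans ht
    have h3 := norm_add_le x (t • N x)
    have h4 : δ ≤ ρ / 2 := min_le_right _ _
    rw [mem_ball_zero_iff]
    linarith
  have hlip : ∀ (u : E → E →L[ℝ] ℝ) (t' : Set E) (K' : NNReal), LipschitzOnWith K' u t' →
      (K' : ℝ) ≤ K → Metric.ball (0 : E) ρ ⊆ t' → ∀ x ∈ S, ∀ t : ℝ, |t| ≤ ε →
      ‖u (x + t • N x) - u x‖ ≤ w x / 4 := by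
    intro u t' K' hu hKK ht' x hx t ht
    have h1 := hu.norm_sub_le (ht' (hball x hx t ht)) (ht' (hBδ hx.1))
    rw [add_sub_cancel_left, norm_smul, hNw, Real.norm_eq_abs] at h1
    have h2 : (K' : ℝ) * |t| ≤ 1 / 4 :=
      (mul_le_mul hKK ht (abs_nonneg t) hK.le).trans hKε
    have h3 := mul_le_mul_of_nonneg_right h2 (hw x hx).le
    linarith
  have hlipf := hlip _ _ _ hK₁ (by linarith [le_max_left (K₁ : ℝ) K₂])
    (fun x hx => (hρN x hx).1.1.1.1.2)
  have hlipg := hlip _ _ _ hK₂ (by linarith [le_max_right (K₁ : ℝ) K₂])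
    (fun x hx => (hρN x hx).1.1.1.2.1)
  have hwy : ∀ x ∈ S, ∀ t : ℝ, |t| ≤ ε → |w (x + t • N x) - w x| ≤ w x / 4 := fun x hx t ht =>
    (abs_norm_sub_norm_le _ _).trans (hlipf x hx t ht)
  have hyT : ∀ x ∈ S, ∀ t : ℝ, |t| ≤ ε → x + t • N x ∈ T := fun x hx t ht =>
    ⟨hball x hx t ht, by linarith [(abs_le.1 (hwy x hx t ht)).1, hw x hx]⟩
  have hq : ∀ x ∈ S, ∀ t : ℝ, |t| ≤ ε → w x ^ 2 / 2 ≤ fderiv ℝ g (x + t • N x) (N x) := by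
    intro x hx t ht
    refine le_fderiv_add_smul_rieszVector (A' := fderiv ℝ g x) ?_ (hlipg x hx t ht)
    refine (hgf1 x (hST hx)).trans ?_
    have := mul_le_mul_of_nonneg_right (hsmall₁ x hx) (hw x hx).le
    have h4 : ‖fderiv ℝ f x‖ = w x := rfl
    linarith
  have hder : ∀ x ∈ S, ∀ t : ℝ, |t| ≤ ε → HasDerivAt (fun t => g (x + t • N x) - f x)
      (fderiv ℝ g (x + t • N x) (N x)) t := by
    intro x hx t ht
    have h1 : HasDerivAt (fun t : ℝ => x + t • N x) (N x) t := by
      simpa using ((hasDerivAt_id t).smul_const (N x)).const_add x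
    exact ((hgd _ (hball x hx t ht)).hasFDerivAt.comp_hasDerivAt t h1).sub_const _
  -- The radius is the initial error C₀w^(p+3) divided by the slope w²/2.
  have hroot : ∀ x, ∃ t : ℝ, x ∈ S → |t| ≤ 2 * C₀ * w x ^ (p + 1) ∧ g (x + t • N x) - f x = 0 ∧
      ∀ t' ∈ Set.Icc (-ε) ε, g (x + t' • N x) - f x = 0 → t' = t := by
    intro x
    by_cases hx : x ∈ S
    · have hb : 2 * C₀ * w x ^ (p + 1) ≤ ε := by
        have h1 : w x ^ (p + 1) ≤ w x := by
          simpa using pow_le_pow_of_le_one (hw x hx).le (hw1 x hx) (show 1 ≤ p + 1 by omega)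
        have h2 := mul_le_mul_of_nonneg_left h1 (show 0 ≤ 2 * C₀ by positivity)
        linarith [hsmall₀ x hx]
      obtain ⟨t, ht⟩ := exists_root_of_le_deriv (G := fun t => g (x + t • N x) - f x)
        (m := w x ^ 2 / 2) (b := 2 * C₀ * w x ^ (p + 1)) (by have := hw x hx; positivity) hb
        (fun t ht => (hder x hx t (abs_le.2 ht)).differentiableAt)
        (fun t ht => by rw [(hder x hx t (abs_le.2 ht)).deriv]; exact hq x hx t (abs_le.2 ht))
        (by
          have := hC₀h x (hST hx)
          rw [show (p : ℤ) + 3 = (p + 3 : ℕ) by push_cast; ring, zpow_natCast,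
            Real.norm_eq_abs, Pi.sub_apply] at this
          simp only [zero_smul, add_zero]
          refine this.trans_eq ?_
          ring)
      exact ⟨t, fun _ => ht⟩
    · exact ⟨0, fun h => absurd h hx⟩
  choose s hs using hroot
  -- The bound ε/2 rather than ε leaves a neighbourhood of s x inside (-ε, ε), where uniqueness of
  -- the root applies.
  have hsε : ∀ x ∈ S, |s x| ≤ ε / 2 := by
    intro x hx
    have h1 : w x ^ (p + 1) ≤ w x := by
      simpa using pow_le_pow_of_le_one (hw x hx).le (hw1 x hx) (show 1 ≤ p + 1 by omega)
    have h2 := mul_le_mul_of_nonneg_left h1 (show 0 ≤ 2 * C₀ by positivity)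
    linarith [hsmall₀ x hx, (hs x hx).1]
  have hscd : ∀ x ∈ S, ContDiffAt ℝ (p + 1 : ℕ) s x := by
    intro x hx
    have hsx : |s x| ≤ ε := (hsε x hx).trans (by linarith)
    have hxρ : x ∈ Metric.ball (0 : E) ρ := hBδ hx.1
    have hGc : ContDiffAt ℝ (p + 1 : ℕ) (fun q : E × ℝ => g (q.1 + q.2 • N q.1) - f q.1)
        (x, s x) := by
      have hN1 : ContDiffAt ℝ (p + 1 : ℕ) (fun q : E × ℝ => N q.1) (x, s x) :=
        ContDiffAt.comp (g := N) (x, s x) (hρN x hxρ).2.1 contDiffAt_fst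
      have hf1 : ContDiffAt ℝ (p + 1 : ℕ) (fun q : E × ℝ => f q.1) (x, s x) :=
        ContDiffAt.comp (x, s x) ((hρN x hxρ).1.2.1.of_le (by norm_cast; omega)) contDiffAt_fst
      have hg1 : ContDiffAt ℝ (p + 1 : ℕ) (fun q : E × ℝ => g (q.1 + q.2 • N q.1)) (x, s x) :=
        ContDiffAt.comp (x, s x)
          ((hρN _ (hball x hx _ hsx)).1.2.2.of_le (by norm_cast; omega))
          (contDiffAt_fst.add (contDiffAt_snd.smul hN1))
      exact hg1.sub hf1
    refine contDiffAt_of_eventually_unique (by simp) hGc (hs x hx).2.1 ?_ ?_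
    · have h1 : HasDerivAt (fun t : ℝ => (x, t)) ((0 : E), (1 : ℝ)) (s x) :=
        (hasDerivAt_const (s x) x).prodMk (hasDerivAt_id (s x))
      have h2 := (hGc.differentiableAt (by simp)).hasFDerivAt.comp_hasDerivAt (s x) h1
      rw [h2.unique (hder x hx _ hsx)]
      have h3 := hw x hx
      exact ((show 0 < w x ^ 2 / 2 by positivity).trans_le (hq x hx _ hsx)).ne'
    · have h1 : ∀ᶠ q : E × ℝ in 𝓝 (x, s x), q.1 ∈ S :=
        continuousAt_fst.eventually (hSo.mem_nhds hx)
      have h2 : ∀ᶠ q : E × ℝ in 𝓝 (x, s x), |q.2| < ε :=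
        (continuousAt_snd (p := (x, s x))).abs.eventually_lt_const
          ((hsε x hx).trans_lt (by linarith))
      filter_upwards [h1, h2] with q hq1 hq2 hq0
      exact (hs q.1 hq1).2.2 q.2 (abs_le.1 hq2.le) hq0
  have htε : ∀ x ∈ S, ∀ t ∈ Set.Icc (0 : ℝ) 1, |t * s x| ≤ ε := by
    intro x hx t ht
    rw [abs_mul, abs_of_nonneg ht.1]
    exact (mul_le_of_le_one_left (abs_nonneg _) ht.2).trans ((hsε x hx).trans (by linarith))
  have hsW : WeightedBound w S (p + 1) (p + 1) s := by
    refine WeightedBound.of_apply_add_smul_eq (T := T) (f := f) (g := g) (N := N) (c := 3 / 4)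
      (d := 2) (e := 1 / 2) hw hw1 hSo hwT (fun x hx t ht => ?_) (by norm_num)
      (fun x hx t ht => ?_) (fun x hx t ht => ?_) (hNW.mono_set hST) hgW (hgf.mono_set hST)
      (fun x hx => hgd x hx.1) ⟨2 * C₀, fun x hx => ?_⟩
      (fun x hx => (hscd x hx).differentiableAt (by simp))
      (fun x hx => sub_eq_zero.1 (hs x hx).2.1) (by norm_num) (fun x hx => ?_) le_rfl
    · rw [smul_smul]
      exact hyT x hx _ (htε x hx t ht)
    · rw [smul_smul]
      linarith [(abs_le.1 (hwy x hx _ (htε x hx t ht))).1]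
    · rw [smul_smul]
      linarith [(abs_le.1 (hwy x hx _ (htε x hx t ht))).2, hw x hx]
    · have := (hs x hx).1
      rwa [← zpow_natCast, Nat.cast_add, Nat.cast_one] at this
    · linarith [hq x hx (s x) ((hsε x hx).trans (by linarith))]
  have hvW : WeightedBound w S (p + 1) (p + 2) (fun x => s x • N x) := by
    have := hsW.smul hw hSo (hNW.mono_set hST)
    rwa [add_assoc, one_add_one_eq_two] at this
  have hNz : ∀ z, w z = 0 → N z = 0 := fun z hz => norm_eq_zero.1 ((hNw z).trans hz)
  -- The values of s on the critical set are arbitrary; the factor N kills them.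
  have hvz : ∀ z ∈ Metric.ball (0 : E) δ, w z = 0 → s z • N z = 0 := fun z _ hz => by
    rw [hNz z hz, smul_zero]
  have hwlip : ∀ x ∈ Metric.ball (0 : E) δ, ∀ z ∈ Metric.ball (0 : E) δ, w z = 0 →
      w x ≤ K₁ * ‖x - z‖ := by
    intro x hx z hz hwz
    have h1 := hK₁.norm_sub_le (hρN x (hBδ hx)).1.1.1.1.2 (hρN z (hBδ hz)).1.1.1.1.2
    rwa [norm_eq_zero.1 hwz, sub_zero] at h1
  have hwB1 : ∀ x ∈ Metric.ball (0 : E) δ, w x ≤ 1 := fun x hx => (hρN x (hBδ hx)).1.1.2.2.le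
  have h0 : (0 : E) ∈ Metric.ball (0 : E) δ := Metric.mem_ball_self hδ
  refine ⟨fun x => s x • N x, ?_, hvz 0 h0 hw00, ?_, ?_⟩
  · refine (WeightedBound.contDiffOn Metric.isOpen_ball (fun x _ => norm_nonneg _) hwB1 hwlip hSo
      (by push_cast; omega) hvW (fun x hx => ?_) hvz).contDiffAt (Metric.isOpen_ball.mem_nhds h0)
    exact ((hscd x hx).smul (hρN x (hBδ hx.1)).2.1).contDiffWithinAt
  · exact (WeightedBound.isBigO_pow Metric.isOpen_ball (fun x _ => norm_nonneg _) hwB1 hwlip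
      (b := 2) (by push_cast; omega) hvW hvz two_ne_zero h0 hw00).hasFDerivAt one_lt_two
  · filter_upwards [Metric.ball_mem_nhds (0 : E) hδ] with x hx
    rcases (norm_nonneg (fderiv ℝ f x)).eq_or_lt with h | h
    · rw [hNz x h.symm, smul_zero, add_zero, hZ x (hρN x (hBδ hx)).1.1.1.1.1 h.symm]
    · exact (sub_eq_zero.1 (hs x ⟨hx, h⟩).2.1).symm

end

/-! ### The inverse function theorem and the conclusion -/

theorem rightEquivalent_of_displacement {n r : ℕ} (hr : 1 ≤ r)
    {f g : EuclideanSpace ℝ (Fin n) → ℝ} {v : EuclideanSpace ℝ (Fin n) → EuclideanSpace ℝ (Fin n)}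
    (hv : ContDiffAt ℝ r v 0) (hv0 : v 0 = 0)
    (hv' : HasFDerivAt v (0 : EuclideanSpace ℝ (Fin n) →L[ℝ] EuclideanSpace ℝ (Fin n)) 0)
    (hfg : ∀ᶠ x in 𝓝 0, f x = g (x + v x)) : RightEquivalent r f g := by
  have hr0 : (r : WithTop ℕ∞) ≠ 0 := by exact_mod_cast (by omega : r ≠ 0)
  have hφ : ContDiffAt ℝ r (fun x => x + v x) 0 := contDiffAt_id.add hv
  have hφ' : HasFDerivAt (fun x => x + v x)
      (ContinuousLinearEquiv.refl ℝ (EuclideanSpace ℝ (Fin n)) :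
        EuclideanSpace ℝ (Fin n) →L[ℝ] EuclideanSpace ℝ (Fin n)) 0 := by
    simpa using! (hasFDerivAt_id (𝕜 := ℝ) (0 : EuclideanSpace ℝ (Fin n))).add hv'
  set e := hφ.toOpenPartialHomeomorph _ hφ' hr0
  have hrω : (r : WithTop ℕ∞) ≠ (⊤ : ℕ∞) := by simp
  have h0 : (0 : EuclideanSpace ℝ (Fin n)) ∈ e.source :=
    hφ.mem_toOpenPartialHomeomorph_source hφ' hr0
  -- The restriction shrinks the local homeomorphism so that it and its inverse are C^r on their
  -- whole domains, not only at 0.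
  refine ⟨e.restrContDiff ℝ r hrω, ⟨h0, hφ, ?_⟩, ?_, e.contDiffOn_restrContDiff_source ℝ hrω,
    e.contDiffOn_restrContDiff_target ℝ hrω, hfg⟩
  · exact hφ.to_localInverse hφ' hr0
  · change 0 + v 0 = 0
    rw [hv0, add_zero]

theorem mainTheorem1 (n r : ℕ) (hr : 1 ≤ r) (f g : EuclideanSpace ℝ (Fin n) → ℝ)
    (hf0 : f 0 = 0) (hg0 : g 0 = 0)
    (hf : ContDiffAt ℝ (r + 1) f 0) (hg : ContDiffAt ℝ (r + 1) g 0)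
    (hgrad : gradient f 0 = 0)
    (hbound : ∃ U ∈ 𝓝 (0 : EuclideanSpace ℝ (Fin n)), ∃ C : ℝ, 0 < C ∧
      ∀ m : Fin n → ℕ, ∑ i, m i ≤ r → ∀ x ∈ U,
        |multiPartialDeriv m (g - f) x| ≤ C * ‖gradient f x‖ ^ (r + 2 - ∑ i, m i)) :
    RightEquivalent r f g := by
  obtain ⟨U, hU, C, -, hC⟩ := hbound
  obtain ⟨p, rfl⟩ : ∃ p, r = p + 1 := ⟨r - 1, by omega⟩
  have hnorm : ∀ x, ‖gradient f x‖ = ‖fderiv ℝ f x‖ := fun x =>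
    (InnerProductSpace.toDual ℝ _).symm.norm_map _
  simp only [hnorm] at hC
  have hf2 : ContDiffAt ℝ (p + 2 : ℕ) f 0 := by exact_mod_cast hf
  have hg2 : ContDiffAt ℝ (p + 2 : ℕ) g 0 := by exact_mod_cast hg
  have hf' : fderiv ℝ f 0 = 0 := by rw [← norm_eq_zero, ← hnorm, hgrad, norm_zero]
  have hDf : ContDiffAt ℝ (1 : ℕ) (fderiv ℝ f) 0 := hf2.fderiv_right (by norm_cast; omega)
  obtain ⟨ρ, hρ, hB⟩ := Metric.eventually_nhds_iff_ball.1
    (((hf2.eventually (natCast_ne_infty _)).and (hg2.eventually (natCast_ne_infty _))).and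
      (Filter.Eventually.and hU (hDf.eventually (by simp))))
  have hS : IsOpen {x ∈ Metric.ball (0 : EuclideanSpace ℝ (Fin n)) ρ | 0 < ‖fderiv ℝ f x‖} := by
    have : ContinuousOn (fun x => ‖fderiv ℝ f x‖) (Metric.ball 0 ρ) := fun x hx =>
      (hB x hx).2.2.continuousAt.norm.continuousWithinAt
    exact this.isOpen_inter_preimage Metric.isOpen_ball isOpen_Ioi
  have hsm : ContDiffOn ℝ (p + 1 : ℕ) (g - f) (Metric.ball 0 ρ) := fun x hx =>
    (((hB x hx).1.2.sub (hB x hx).1.1).of_le (by norm_cast; omega)).contDiffWithinAt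
  obtain ⟨v, hv, hv0, hv', hfg⟩ := exists_displacement hf2 hg2 hf'
    (Metric.ball_mem_nhds (0 : EuclideanSpace ℝ (Fin n)) hρ) (fun x hx hx0 => by
      -- The multi-index 0 gives |g - f| ≤ C w^(r+2), which vanishes at critical points.
      have := hC 0 (by simp) x (hB x hx).2.1
      rw [multiPartialDeriv_eq_wordDeriv] at this
      simpa [wordDeriv, hx0, sub_eq_zero, List.flatMap_eq_nil_iff.2] using this)
    (WeightedBound.of_wordDeriv Metric.isOpen_ball hS (fun x hx => hx.1) hsm fun l hl =>
      ⟨C, fun x hx => by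
        have hsum : ∑ i, l.count i = l.length := by
          simp [← Multiset.coe_count]
        have := hC (fun i => l.count i) (by rwa [hsum]) x (hB x hx.1).2.1
        rw [wordDeriv_eq_multiPartialDeriv Metric.isOpen_ball l
          (hsm.of_le (by exact_mod_cast hl)) hx.1, Real.norm_eq_abs]
        -- The truncated subtraction in the exponent is exact because the word has length at most r.
        rw [hsum, ← zpow_natCast, Nat.cast_sub (by omega)] at this
        convert this using 3
        push_cast
        ring⟩)
  exact rightEquivalent_of_displacement hr hv hv0 hv' hfg
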